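/- **Theorem 4.1.** Let $n\ge 1$ and let $B_r=\{x\in\mathbb R^n:|x|<r\}$. Let $W\in L^\infty_{loc}(B_1\setminus\{0\})$ be real-valued with $W\ge 0$ a.e. on $B_1$. Assume that $W\notin L^1(U)$ for every neighborhood $U$ of $0$, and that $$\int_{B_r}\frac{1}{|x|^{n+2}W(x)}\,dx<\infty\quad\text{for some } r>0,$$ where the integrand is $+\infty$ wherever $W=0$. Let $w\in L^1_{loc}(B_1\setminus\{0\})$ be a real-valued weak solution of $-\Delta w=Ww$ on $B_1\setminus\{0\}$, that is, $$-\int_{B_1\setminus\{0\}} w\,\Delta\varphi\,dx=\int_{B_1\setminus\{0\}} W\,w\,\varphi\,dx\quad\text{for all }\varphi\in C_c^\infty(B_1\setminus\{0\}),$$ and suppose that $w=O(|x|^{2-n})$ near $0$, i.e. there are $C,\rho>0$ with $|w(x)|\le C|x|^{2-n}$ for a.e. $x\in B_\rho$. If $w\ge 0$ a.e. on $B_1$, or $w\le 0$ a.e. on $B_1$, then $w=0$ a.e. on $B_1$. -/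

import Mathlib

open MeasureTheory Filter Topology
open scoped ENNReal ContDiff Laplacian

/-- `f ∈ L^∞_loc(U)`: `f` is (a.e. strongly measurable and) essentially bounded on every
compact subset of `U`. -/
def MemLinftyLoc {n : ℕ} (f : EuclideanSpace ℝ (Fin n) → ℝ)
    (U : Set (EuclideanSpace ℝ (Fin n))) : Prop :=
  ∀ K : Set (EuclideanSpace ℝ (Fin n)), K ⊆ U → IsCompact K →
    MemLp f ∞ (volume.restrict K)

/-- `w` is a weak (distributional) solution of `-Δ w = W w` on `U`: tested against every smooth
function `φ` whose support is a compact subset of `U`. It is meant for `U` open and for `w` and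
`W w` locally integrable on `U`, so that both integrals converge. -/
def IsWeakSolution {n : ℕ} (W w : EuclideanSpace ℝ (Fin n) → ℝ)
    (U : Set (EuclideanSpace ℝ (Fin n))) : Prop :=
  ∀ φ : EuclideanSpace ℝ (Fin n) → ℝ, ContDiff ℝ ∞ φ → HasCompactSupport φ → tsupport φ ⊆ U →
    ∫ x in U, w x * (-(Δ φ) x) = ∫ x in U, W x * w x * φ x

/-!
Testing the equation with cutoffs that excise the ball of radius `ε` about the origin, the growth
bound on `w` keeps the left-hand side bounded as `ε → 0`, so `W w` is integrable near the origin.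
By AM-GM the growth bound also gives `w / |x|² ≤ C W w + 1 / (|x|^(n+2) W)`, so `w / |x|²` is
integrable near the origin. This is what makes the error terms of the same cutoffs vanish in the
limit: `w` is superharmonic across the origin. The strong minimum principle, obtained from the
monotonicity of ball means in the radius, then says that either `w = 0` or `w ≥ c > 0` near the
origin; in the latter case `W ≤ W w / c` would be integrable there.
-/

open Metric Module
open scoped Gradient

section Laplacian

variable {E : Type*} [NormedAddCommGroup E] [InnerProductSpace ℝ E] [FiniteDimensional ℝ E]
  {f g : E → ℝ} {x : E}

theorem laplacian_eq_sum_of_hasFDerivAt {ι : Type*} [Fintype ι] (v : OrthonormalBasis ι ℝ E)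
    {f' : E → E →L[ℝ] ℝ} {f'' : E →L[ℝ] E →L[ℝ] ℝ}
    (hf : ∀ᶠ y in 𝓝 x, HasFDerivAt f (f' y) y) (hf' : HasFDerivAt f' f'' x) :
    (Δ f) x = ∑ i, f'' (v i) (v i) := by
  have hfderiv : fderiv ℝ f =ᶠ[𝓝 x] f' := hf.mono fun y hy => hy.fderiv
  simp [InnerProductSpace.laplacian_eq_iteratedFDeriv_orthonormalBasis f v,
    iteratedFDeriv_two_apply, hfderiv.fderiv_eq, hf'.fderiv]

theorem inner_gradient_eq_sum_fderiv_mul {ι : Type*} [Fintype ι] (v : OrthonormalBasis ι ℝ E) :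
    inner ℝ (∇ f x) (∇ g x) = ∑ i, fderiv ℝ f x (v i) * fderiv ℝ g x (v i) := by
  rw [← v.sum_inner_mul_inner]
  simp only [inner_gradient_left, inner_gradient_right, conj_trivial]

theorem norm_gradient_eq_norm_fderiv : ‖∇ f x‖ = ‖fderiv ℝ f x‖ := by
  rw [← toDual_gradient, LinearIsometryEquiv.norm_map]

theorem laplacian_mul (hf : ContDiffAt ℝ 2 f x) (hg : ContDiffAt ℝ 2 g x) :
    (Δ fun y => f y * g y) x = f x * (Δ g) x + 2 * inner ℝ (∇ f x) (∇ g x) + g x * (Δ f) x := by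
  have hfst {h : E → ℝ} (hh : ContDiffAt ℝ 2 h x) :
      ∀ᶠ y in 𝓝 x, HasFDerivAt h (fderiv ℝ h y) y := by
    filter_upwards [hh.eventually (by simp)] with y hy
    exact (hy.differentiableAt (by simp)).hasFDerivAt
  have hsnd {h : E → ℝ} (hh : ContDiffAt ℝ 2 h x) :
      HasFDerivAt (fderiv ℝ h) (fderiv ℝ (fderiv ℝ h) x) x :=
    ((hh.fderiv_right (m := 1) (by norm_num)).differentiableAt (by simp)).hasFDerivAt
  set v := stdOrthonormalBasis ℝ E
  have hfg : ∀ᶠ y in 𝓝 x,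
      HasFDerivAt (fun y => f y * g y) (f y • fderiv ℝ g y + g y • fderiv ℝ f y) y := by
    filter_upwards [hfst hf, hfst hg] with y hfy hgy using hfy.mul hgy
  have hfg' := ((hfst hf).self_of_nhds.smul (hsnd hg)).add
    ((hfst hg).self_of_nhds.smul (hsnd hf))
  rw [laplacian_eq_sum_of_hasFDerivAt v hfg hfg',
    laplacian_eq_sum_of_hasFDerivAt v (hfst hf) (hsnd hf),
    laplacian_eq_sum_of_hasFDerivAt v (hfst hg) (hsnd hg), inner_gradient_eq_sum_fderiv_mul v,
    Finset.mul_sum, Finset.mul_sum, Finset.mul_sum, ← Finset.sum_add_distrib,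
    ← Finset.sum_add_distrib]
  refine Finset.sum_congr rfl fun i _ => ?_
  simp only [add_apply, smul_apply, ContinuousLinearMap.smulRight_apply, smul_eq_mul]
  ring

theorem laplacian_comp_norm_sub_sq {P : ℝ → ℝ} (hP : ContDiff ℝ 2 P) (x₀ : E) :
    (Δ fun y => P (‖y - x₀‖ ^ 2)) x =
      4 * ‖x - x₀‖ ^ 2 * deriv (deriv P) (‖x - x₀‖ ^ 2)
        + 2 * finrank ℝ E * deriv P (‖x - x₀‖ ^ 2) := by
  have hsq (y : E) : HasFDerivAt (fun y => ‖y - x₀‖ ^ 2) ((2 : ℝ) • innerSL ℝ (y - x₀)) y := by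
    refine (((hasFDerivAt_id y).sub_const x₀).norm_sq).congr_fderiv ?_
    ext z
    simp [two_mul]
  have hsq' : HasFDerivAt (fun y => (2 : ℝ) • innerSL ℝ (y - x₀))
      ((2 : ℝ) • (innerSL ℝ : E →L[ℝ] E →L[ℝ] ℝ)) x :=
    (((innerSL ℝ : E →L[ℝ] E →L[ℝ] ℝ).hasFDerivAt (x := x - x₀)).comp x
      ((hasFDerivAt_id x).sub_const x₀)).const_smul (2 : ℝ)
  have hP' : ContDiff ℝ 1 (deriv P) := hP.deriv' (n := 1)
  have hfst (y : E) : HasFDerivAt (fun y => P (‖y - x₀‖ ^ 2))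
      (deriv P (‖y - x₀‖ ^ 2) • (2 : ℝ) • innerSL ℝ (y - x₀)) y :=
    (hP.differentiable (by simp) _).hasDerivAt.comp_hasFDerivAt y (hsq y)
  have hsnd := ((hP'.differentiable (by simp) _).hasDerivAt.comp_hasFDerivAt x (hsq x)).smul hsq'
  set v := stdOrthonormalBasis ℝ E
  have hparseval : ∑ i, inner ℝ (x - x₀) (v i) ^ 2 = ‖x - x₀‖ ^ 2 := by
    rw [← v.sum_sq_norm_inner_left]
    simp
  have hdim : ∑ i, inner ℝ (v i) (v i) = (finrank ℝ E : ℝ) := by simp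
  rw [laplacian_eq_sum_of_hasFDerivAt v (Eventually.of_forall hfst) hsnd, ← hparseval, ← hdim,
    Finset.mul_sum, Finset.mul_sum, Finset.sum_mul, Finset.sum_mul, ← Finset.sum_add_distrib]
  refine Finset.sum_congr rfl fun i _ => ?_
  have hself : innerSL ℝ (v i) (v i) = inner ℝ (v i) (v i) := rfl
  simp only [Function.comp_apply, add_apply, smul_apply,
    ContinuousLinearMap.smulRight_apply, innerSL_apply_apply, smul_eq_mul, hparseval]
  rw [hself]
  ring

theorem laplacian_comp_smul (hf : ContDiff ℝ 2 f) (c : ℝ) (x : E) :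
    (Δ fun y => f (c • y)) x = c ^ 2 * (Δ f) (c • x) := by
  simp [InnerProductSpace.laplacian_eq_iteratedFDeriv_stdOrthonormalBasis,
    iteratedFDeriv_comp_const_smul c hf, Finset.mul_sum]

theorem continuous_laplacian (hf : ContDiff ℝ 2 f) : Continuous (Δ f) := by
  rw [InnerProductSpace.laplacian_eq_iteratedFDeriv_stdOrthonormalBasis]
  refine continuous_finsetSum _ fun i _ => ?_
  exact (continuous_eval_const _).comp (hf.continuous_iteratedFDeriv (m := 2) le_rfl)

theorem laplacian_eq_zero_of_notMem_tsupport (hx : x ∉ tsupport f) : (Δ f) x = 0 := by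
  rw [(InnerProductSpace.laplacian_congr_nhds (notMem_tsupport_iff_eventuallyEq.1 hx)).eq_of_nhds]
  exact congrFun (InnerProductSpace.laplacian_const (c := (0 : ℝ))) x

end Laplacian

section ExpNegInvGlue

theorem deriv_eq_zero_of_forall_le_eq_zero {f : ℝ → ℝ} {a : ℝ} (hf : ∀ x ≤ a, f x = 0) :
    deriv f a = 0 := by
  by_cases hd : DifferentiableAt ℝ f a
  · rw [← hd.derivWithin (uniqueDiffWithinAt_Iic a),
      derivWithin_congr (s := Set.Iic a) (f := fun _ => (0 : ℝ)) hf (hf a le_rfl)]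
    simp
  · exact deriv_zero_of_not_differentiableAt hd

theorem contDiff_deriv_expNegInvGlue : ContDiff ℝ ∞ (deriv expNegInvGlue) :=
  (contDiff_infty_iff_deriv.1 expNegInvGlue.contDiff).2

theorem contDiff_deriv_deriv_expNegInvGlue : ContDiff ℝ ∞ (deriv (deriv expNegInvGlue)) :=
  (contDiff_infty_iff_deriv.1 contDiff_deriv_expNegInvGlue).2

theorem deriv_expNegInvGlue (x : ℝ) : deriv expNegInvGlue x = x⁻¹ ^ 2 * expNegInvGlue x := by
  simpa using (expNegInvGlue.hasDerivAt_polynomial_eval_inv_mul 1 x).deriv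

theorem deriv_expNegInvGlue_nonneg (x : ℝ) : 0 ≤ deriv expNegInvGlue x := by
  rw [deriv_expNegInvGlue]
  exact mul_nonneg (by positivity) (expNegInvGlue.nonneg x)

theorem deriv_expNegInvGlue_of_nonpos {x : ℝ} (hx : x ≤ 0) : deriv expNegInvGlue x = 0 :=
  deriv_eq_zero_of_forall_le_eq_zero fun _ hy => expNegInvGlue.zero_of_nonpos (hy.trans hx)

theorem deriv_deriv_expNegInvGlue_of_nonpos {x : ℝ} (hx : x ≤ 0) :
    deriv (deriv expNegInvGlue) x = 0 :=
  deriv_eq_zero_of_forall_le_eq_zero fun _ hy => deriv_expNegInvGlue_of_nonpos (hy.trans hx)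

theorem expNegInvGlue_le_deriv {a x : ℝ} (ha : 0 < a) (hax : a ≤ x) (hx : x ≤ 1) :
    expNegInvGlue a ≤ deriv expNegInvGlue x := by
  have hinv : 1 ≤ x⁻¹ := (one_le_inv₀ (ha.trans_le hax)).2 hx
  rw [deriv_expNegInvGlue]
  exact (expNegInvGlue.monotone hax).trans
    (le_mul_of_one_le_left (expNegInvGlue.nonneg x) (one_le_pow₀ hinv))

theorem exists_bound_of_eq_zero_of_nonpos {f : ℝ → ℝ} (hf : Continuous f)
    (hzero : ∀ x ≤ 0, f x = 0) : ∃ M > 0, ∀ x ≤ 1, |f x| ≤ M := by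
  obtain ⟨M, hM⟩ := (isCompact_Icc (a := (0 : ℝ)) (b := 1)).exists_bound_of_continuousOn
    hf.continuousOn
  refine ⟨max M 1, by positivity, fun x hx => ?_⟩
  rcases le_or_gt x 0 with h | h
  · simp [hzero x h]
  · exact (hM x ⟨h.le, hx⟩).trans (le_max_left _ _)

end ExpNegInvGlue

section RadialKernel

variable {E : Type*} [NormedAddCommGroup E] {x y : E} {t : ℝ}

/-- A smooth radial bump, positive on the open ball of radius `t` about `x` and zero off it. -/
noncomputable def radialBump (x : E) (t : ℝ) (y : E) : ℝ :=
  expNegInvGlue (1 - ‖y - x‖ ^ 2 / t ^ 2)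

theorem one_sub_norm_sub_sq_div_nonpos (ht : 0 < t) (hy : y ∉ closedBall x t) :
    1 - ‖y - x‖ ^ 2 / t ^ 2 ≤ 0 := by
  rw [mem_closedBall, dist_eq_norm, not_le] at hy
  rw [sub_nonpos, one_le_div (by positivity)]
  gcongr

theorem tsupport_radialBump_subset (x : E) (ht : 0 < t) :
    tsupport (radialBump x t) ⊆ closedBall x t := by
  refine closure_minimal (fun y hy => ?_) isClosed_closedBall
  by_contra hyt
  exact hy (expNegInvGlue.zero_of_nonpos (one_sub_norm_sub_sq_div_nonpos ht hyt))

variable [InnerProductSpace ℝ E]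

theorem contDiff_radialBump (x : E) (t : ℝ) : ContDiff ℝ ∞ (radialBump x t) :=
  expNegInvGlue.contDiff.comp
    (contDiff_const.sub (((contDiff_id.sub contDiff_const).norm_sq ℝ).div_const _))

/-- The averaging kernel on the ball of radius `t` about `x` whose derivative in `t` is a positive
multiple of the Laplacian of `radialBump x t`. Its mass is independent of `t` but not
normalized to `1`. -/
noncomputable def radialKernel (x : E) (t : ℝ) (y : E) : ℝ :=
  (t ^ finrank ℝ E)⁻¹ * deriv expNegInvGlue (1 - ‖y - x‖ ^ 2 / t ^ 2)

theorem continuous_radialKernel (x : E) (t : ℝ) : Continuous (radialKernel x t) :=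
  continuous_const.mul (contDiff_deriv_expNegInvGlue.continuous.comp (by fun_prop))

theorem radialKernel_nonneg (ht : 0 < t) (x y : E) : 0 ≤ radialKernel x t y :=
  mul_nonneg (by positivity) (deriv_expNegInvGlue_nonneg _)

theorem radialKernel_eq_zero (ht : 0 < t) (hy : y ∉ closedBall x t) : radialKernel x t y = 0 := by
  rw [radialKernel, deriv_expNegInvGlue_of_nonpos (one_sub_norm_sub_sq_div_nonpos ht hy), mul_zero]

theorem le_radialKernel (ht : 0 < t) {q : ℝ} (hq : q < 1) (hy : ‖y - x‖ ^ 2 ≤ q * t ^ 2) :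
    (t ^ finrank ℝ E)⁻¹ * expNegInvGlue (1 - q) ≤ radialKernel x t y := by
  unfold radialKernel
  gcongr
  refine expNegInvGlue_le_deriv (sub_pos.2 hq) ?_ (sub_le_self _ (by positivity))
  gcongr
  rwa [div_le_iff₀ (by positivity)]

theorem exists_radialKernel_le (E : Type*) [NormedAddCommGroup E] [InnerProductSpace ℝ E] :
    ∃ M > 0, ∀ (x : E), ∀ t > 0, ∀ y, radialKernel x t y ≤ (t ^ finrank ℝ E)⁻¹ * M := by
  obtain ⟨M, hM, hbound⟩ := exists_bound_of_eq_zero_of_nonpos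
    contDiff_deriv_expNegInvGlue.continuous fun _ => deriv_expNegInvGlue_of_nonpos
  refine ⟨M, hM, fun x t ht y => ?_⟩
  unfold radialKernel
  gcongr
  exact (le_abs_self _).trans (hbound _ (sub_le_self _ (by positivity)))

variable [FiniteDimensional ℝ E]

theorem laplacian_radialBump (x : E) (t : ℝ) (y : E) :
    (Δ (radialBump x t)) y = (t ^ 2)⁻¹ *
      (4 * (‖y - x‖ ^ 2 / t ^ 2) * deriv (deriv expNegInvGlue) (1 - ‖y - x‖ ^ 2 / t ^ 2)
        - 2 * finrank ℝ E * deriv expNegInvGlue (1 - ‖y - x‖ ^ 2 / t ^ 2)) := by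
  have hlin (s : ℝ) : HasDerivAt (fun s : ℝ => 1 - s / t ^ 2) (-(t ^ 2)⁻¹) s := by
    simpa using! ((hasDerivAt_id s).div_const (t ^ 2)).const_sub 1
  have hfst : deriv (fun s => expNegInvGlue (1 - s / t ^ 2)) =
      fun s => deriv expNegInvGlue (1 - s / t ^ 2) * -(t ^ 2)⁻¹ := funext fun s =>
    ((expNegInvGlue.contDiff (n := 1).differentiable one_ne_zero _).hasDerivAt.comp s
      (hlin s)).deriv
  have hsnd (s : ℝ) : deriv (fun s => deriv expNegInvGlue (1 - s / t ^ 2) * -(t ^ 2)⁻¹) s =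
      deriv (deriv expNegInvGlue) (1 - s / t ^ 2) * -(t ^ 2)⁻¹ * -(t ^ 2)⁻¹ :=
    (((contDiff_deriv_expNegInvGlue.differentiable (by simp) _).hasDerivAt.comp s
      (hlin s)).mul_const _).deriv
  have hsmooth : ContDiff ℝ 2 fun s => expNegInvGlue (1 - s / t ^ 2) :=
    expNegInvGlue.contDiff.comp (contDiff_const.sub (contDiff_id.div_const _))
  unfold radialBump
  rw [laplacian_comp_norm_sub_sq hsmooth, hfst, hsnd]
  ring

theorem exists_bound_laplacian_radialBump (E : Type*) [NormedAddCommGroup E]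
    [InnerProductSpace ℝ E] [FiniteDimensional ℝ E] :
    ∃ Q, ∀ (x : E) (t : ℝ) (y : E), |(Δ (radialBump x t)) y| ≤ (t ^ 2)⁻¹ * Q := by
  obtain ⟨Q, -, hQ⟩ := exists_bound_of_eq_zero_of_nonpos
    (f := fun s => 4 * (1 - s) * deriv (deriv expNegInvGlue) s
      - 2 * finrank ℝ E * deriv expNegInvGlue s)
    (.sub (.mul (by fun_prop) contDiff_deriv_deriv_expNegInvGlue.continuous)
      (.mul (by fun_prop) contDiff_deriv_expNegInvGlue.continuous))
    fun s hs => by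
      simp [deriv_expNegInvGlue_of_nonpos hs, deriv_deriv_expNegInvGlue_of_nonpos hs]
  refine ⟨Q, fun x t y => ?_⟩
  rw [laplacian_radialBump, abs_mul, abs_of_nonneg (by positivity : (0 : ℝ) ≤ (t ^ 2)⁻¹)]
  gcongr
  simpa using hQ (1 - ‖y - x‖ ^ 2 / t ^ 2) (sub_le_self _ (by positivity))

theorem hasDerivAt_radialKernel (x y : E) (ht : 0 < t) :
    HasDerivAt (fun t => radialKernel x t y)
      (t / 2 * (t ^ finrank ℝ E)⁻¹ * (Δ (radialBump x t)) y) t := by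
  have hprofile : HasDerivAt (fun t : ℝ => 1 - ‖y - x‖ ^ 2 / t ^ 2)
      (2 * ‖y - x‖ ^ 2 / t ^ 3) t := by
    refine ((((hasDerivAt_pow 2 t).fun_inv (by positivity)).const_mul _).const_sub 1).congr_deriv ?_
    simp only [Nat.cast_ofNat, Nat.add_one_sub_one, pow_one]
    field_simp
  have hkernel := ((hasDerivAt_pow (finrank ℝ E) t).fun_inv (by positivity)).fun_mul
    ((contDiff_deriv_expNegInvGlue.differentiable (by simp) _).hasDerivAt.comp t hprofile)
  refine hkernel.congr_deriv ?_
  rw [laplacian_radialBump]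
  rcases finrank ℝ E with _ | d
  · simp only [CharP.cast_eq_zero, zero_tsub, pow_zero, mul_one, neg_zero, one_pow, div_one,
      Function.comp_apply, zero_mul, inv_one, one_mul, zero_add, mul_zero, sub_zero]
    field_simp
    norm_num
  · simp only [Nat.cast_add, Nat.cast_one, add_tsub_cancel_right, Function.comp_apply]
    field_simp
    ring

end RadialKernel

section AlmostEverywhereNear

variable {X : Type*} [TopologicalSpace X] [MeasurableSpace X] {μ : Measure X} {p : X → Prop}
  {s : Set X} {x : X}

theorem eventually_nhds_inf_ae_of_ae_restrict (hs : s ∈ 𝓝 x) (hp : ∀ᵐ y ∂μ.restrict s, p y) :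
    ∀ᶠ y in 𝓝 x ⊓ ae μ, p y :=
  eventually_inf.2 ⟨s, hs, _, ae_imp_of_ae_restrict hp, fun _ hy => hy.2 hy.1⟩

theorem exists_isOpen_ae_of_eventually_nhds_inf_ae (hp : ∀ᶠ y in 𝓝 x ⊓ ae μ, p y) :
    ∃ u, IsOpen u ∧ x ∈ u ∧ ∀ᵐ y ∂μ, y ∈ u → p y := by
  obtain ⟨s, hs, t, ht, hst⟩ := eventually_inf.1 hp
  obtain ⟨u, hus, hu, hxu⟩ := mem_nhds_iff.1 hs
  exact ⟨u, hu, hxu, by filter_upwards [ht] with y hyt hyu using hst y ⟨hus hyu, hyt⟩⟩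

theorem isOpen_setOf_eventually_nhds_inf_ae : IsOpen {x | ∀ᶠ y in 𝓝 x ⊓ ae μ, p y} := by
  refine isOpen_iff_mem_nhds.2 fun x hx => ?_
  obtain ⟨u, hu, hxu, hp⟩ := exists_isOpen_ae_of_eventually_nhds_inf_ae hx
  filter_upwards [hu.mem_nhds hxu] with y hyu
  exact eventually_inf.2 ⟨u, hu.mem_nhds hyu, _, hp, fun _ hz => hz.2 hz.1⟩

theorem nhds_inf_ae_neBot [μ.IsOpenPosMeasure] (x : X) : (𝓝 x ⊓ ae μ).NeBot := by
  refine inf_neBot_iff.2 fun {u} hu t ht => ?_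
  by_contra hempty
  have hut : u ⊆ tᶜ := fun y hyu hyt => hempty ⟨y, hyu, hyt⟩
  exact (Measure.measure_pos_of_mem_nhds μ hu).ne' (measure_mono_null hut ht)

theorem ae_restrict_of_forall_eventually_nhds_inf_ae [SecondCountableTopology X]
    (hs : MeasurableSet s) (hp : ∀ x ∈ s, ∀ᶠ y in 𝓝 x ⊓ ae μ, p y) : ∀ᵐ y ∂μ.restrict s, p y := by
  rw [ae_restrict_iff' hs, ae_iff]
  refine measure_null_of_locally_null _ fun x hx => ?_
  simp only [Set.mem_ofPred_eq, Classical.not_imp] at hx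
  obtain ⟨u, hu, hxu, hpu⟩ := exists_isOpen_ae_of_eventually_nhds_inf_ae (hp x hx.1)
  refine ⟨u ∩ {y | ¬(y ∈ s → p y)}, inter_mem (mem_nhdsWithin_of_mem_nhds (hu.mem_nhds hxu))
    self_mem_nhdsWithin, measure_mono_null ?_ hpu⟩
  exact fun y hy hyp => hy.2 fun _ => hyp hy.1

theorem sdiff_singleton_mem_nhds_inf_ae [NullSingletonClass μ] (hs : s ∈ 𝓝 x) :
    s \ {x} ∈ 𝓝 x ⊓ ae μ :=
  inter_mem_inf hs (Measure.ae_ne μ x)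

end AlmostEverywhereNear

section Superharmonic

variable {E : Type*} [NormedAddCommGroup E] [InnerProductSpace ℝ E] [FiniteDimensional ℝ E]
  [MeasurableSpace E] [BorelSpace E] {w : E → ℝ} {U : Set E} {x x₀ : E} {R t δ : ℝ}

/-- `w` is weakly superharmonic on `U`: `-Δ w ≥ 0` in the sense of distributions. It is meant for
`U` open and `w` locally integrable on `U`, so that the integrals converge. -/
def WeaklySuperharmonicOn (w : E → ℝ) (U : Set E) : Prop :=
  ∀ φ : E → ℝ, ContDiff ℝ ∞ φ → HasCompactSupport φ → tsupport φ ⊆ U → (∀ x, 0 ≤ φ x) →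
    ∫ x, w x * (Δ φ) x ≤ 0

/-- The mean of `w` over the ball of radius `t` about `x`, up to a constant factor and weighted by
`radialKernel`. -/
noncomputable def radialMean (w : E → ℝ) (x : E) (t : ℝ) : ℝ :=
  ∫ y, w y * radialKernel x t y

theorem integrableOn_mul_radialKernel (hw : IntegrableOn w (closedBall x R)) :
    IntegrableOn (fun y => w y * radialKernel x t y) (closedBall x R) :=
  hw.mul_continuousOn (continuous_radialKernel x t).continuousOn (isCompact_closedBall x R)

theorem radialMean_eq_setIntegral (w : E → ℝ) (x : E) (ht : 0 < t) (htR : t ≤ R) :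
    radialMean w x t = ∫ y in closedBall x R, w y * radialKernel x t y := by
  refine (setIntegral_eq_integral_of_forall_compl_eq_zero fun y hy => ?_).symm
  rw [radialKernel_eq_zero ht fun h => hy (closedBall_subset_closedBall htR h), mul_zero]

theorem hasDerivAt_radialMean (hw : IntegrableOn w (closedBall x R)) (ht : t ∈ Set.Ioo 0 R) :
    HasDerivAt (radialMean w x)
      (t / 2 * (t ^ finrank ℝ E)⁻¹ * ∫ y, w y * (Δ (radialBump x t)) y) t := by
  obtain ⟨Q, hQ⟩ := exists_bound_laplacian_radialBump E
  have hQ0 : 0 ≤ Q := by simpa using (abs_nonneg _).trans (hQ 0 1 0)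
  have ht0 : 0 < t := ht.1
  have hlocal : radialMean w x =ᶠ[𝓝 t]
      fun s => ∫ y in closedBall x R, w y * radialKernel x s y := by
    filter_upwards [Ioo_mem_nhds ht.1 ht.2] with s hs
    exact radialMean_eq_setIntegral w x hs.1 hs.2.le
  have hderiv := (hasDerivAt_integral_of_dominated_loc_of_deriv_le
    (μ := volume.restrict (closedBall x R)) (F := fun s y => w y * radialKernel x s y)
    (F' := fun s y => w y * (s / 2 * (s ^ finrank ℝ E)⁻¹ * (Δ (radialBump x s)) y))
    (bound := fun y => ‖w y‖ *
      (R / 2 * ((t / 2) ^ finrank ℝ E)⁻¹ * (((t / 2) ^ 2)⁻¹ * Q)))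
    (Ioo_mem_nhds (half_lt_self ht0) ht.2)
    (Eventually.of_forall fun s => (integrableOn_mul_radialKernel hw).aestronglyMeasurable)
    (integrableOn_mul_radialKernel hw)
    (hw.aestronglyMeasurable.mul ((continuous_laplacian ((contDiff_radialBump x t).of_le
      (WithTop.coe_le_coe.2 le_top))).const_mul _).aestronglyMeasurable)
    (Eventually.of_forall fun y s hs => ?_) (hw.norm.mul_const _)
    (Eventually.of_forall fun y s hs => (hasDerivAt_radialKernel x y
      ((half_pos ht0).trans hs.1)).const_mul _)).2
  · refine (hderiv.congr_of_eventuallyEq hlocal).congr_deriv ?_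
    rw [← integral_const_mul, setIntegral_eq_integral_of_forall_compl_eq_zero]
    · exact integral_congr_ae (Eventually.of_forall fun y => mul_left_comm _ _ _)
    · intro y hy
      rw [laplacian_eq_zero_of_notMem_tsupport, mul_zero, mul_zero]
      exact fun h => hy (closedBall_subset_closedBall ht.2.le (tsupport_radialBump_subset x ht0 h))
  · have hs0 : 0 < s := (half_pos ht0).trans hs.1
    have hR : 0 < R := ht0.trans ht.2
    rw [norm_mul, norm_mul, norm_mul, norm_inv, norm_pow, norm_div, Real.norm_ofNat,
      Real.norm_of_nonneg hs0.le]
    gcongr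
    · exact hs.2.le
    · exact hs.1.le
    · refine (hQ x s y).trans ?_
      gcongr
      exact hs.1.le

theorem WeaklySuperharmonicOn.antitoneOn_radialMean (hw : WeaklySuperharmonicOn w U)
    (hRU : closedBall x R ⊆ U) (hint : IntegrableOn w (closedBall x R)) :
    AntitoneOn (radialMean w x) (Set.Ioo 0 R) := by
  refine antitoneOn_of_hasDerivWithinAt_nonpos (convex_Ioo 0 R)
    (fun t ht => (hasDerivAt_radialMean hint ht).continuousAt.continuousWithinAt)
    (fun t ht => (hasDerivAt_radialMean hint (interior_subset ht)).hasDerivWithinAt) ?_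
  intro t ht
  rw [interior_Ioo] at ht
  have hsupp := tsupport_radialBump_subset x ht.1
  have ht0 : 0 < t := ht.1
  refine mul_nonpos_of_nonneg_of_nonpos (by positivity) ?_
  exact hw _ (contDiff_radialBump x t)
    ((isCompact_closedBall x t).of_isClosed_subset (isClosed_tsupport _) hsupp)
    (hsupp.trans ((closedBall_subset_closedBall ht.2.le).trans hRU))
    fun y => expNegInvGlue.nonneg _

theorem le_radialMean (hδ : 0 < δ) (hx : dist x x₀ ≤ δ)
    (hint : IntegrableOn w (closedBall x (3 * δ)))
    (hnonneg : ∀ᵐ y ∂volume.restrict (closedBall x (3 * δ)), 0 ≤ w y) :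
    ((3 * δ) ^ finrank ℝ E)⁻¹ * expNegInvGlue (5 / 9) * ∫ y in ball x₀ δ, w y
      ≤ radialMean w x (3 * δ) := by
  have hdist {y : E} (hy : y ∈ ball x₀ δ) : ‖y - x‖ ≤ 2 * δ := by
    rw [← dist_eq_norm]
    linarith [dist_triangle_right y x x₀, mem_ball.1 hy]
  have hsub : ball x₀ δ ⊆ closedBall x (3 * δ) := fun y hy => by
    rw [mem_closedBall, dist_eq_norm]
    linarith [hdist hy]
  rw [radialMean_eq_setIntegral w x (by positivity) le_rfl, ← integral_const_mul]
  calc ∫ y in ball x₀ δ, ((3 * δ) ^ finrank ℝ E)⁻¹ * expNegInvGlue (5 / 9) * w y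
      ≤ ∫ y in ball x₀ δ, w y * radialKernel x (3 * δ) y := by
        refine setIntegral_mono_on_ae ((hint.mono_set hsub).const_mul _)
          ((integrableOn_mul_radialKernel hint).mono_set hsub) measurableSet_ball ?_
        filter_upwards [(ae_restrict_iff' measurableSet_closedBall).1 hnonneg] with y hy hyB
        have hkernel := le_radialKernel (x := x) (y := y) (q := 4 / 9)
          (by positivity : 0 < 3 * δ) (by norm_num)
          ((pow_le_pow_left₀ (norm_nonneg _) (hdist hyB) 2).trans_eq (by ring))
        rw [show (1 : ℝ) - 4 / 9 = 5 / 9 by norm_num] at hkernel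
        exact (mul_comm _ _).trans_le (mul_le_mul_of_nonneg_left hkernel (hy (hsub hyB)))
    _ ≤ ∫ y in closedBall x (3 * δ), w y * radialKernel x (3 * δ) y := by
        refine setIntegral_mono_set (integrableOn_mul_radialKernel hint) ?_
          (Eventually.of_forall hsub)
        filter_upwards [hnonneg] with y hy
        exact mul_nonneg hy (radialKernel_nonneg (by positivity) x y)

theorem exists_radialMean_le_setAverage (E : Type*) [NormedAddCommGroup E]
    [InnerProductSpace ℝ E] [FiniteDimensional ℝ E] [MeasurableSpace E] [BorelSpace E] :
    ∃ M > 0, ∀ (w : E → ℝ) (x : E), ∀ t > 0, IntegrableOn w (closedBall x t) →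
      (∀ᵐ y ∂volume.restrict (closedBall x t), 0 ≤ w y) →
      radialMean w x t ≤ M * ⨍ y in closedBall x t, w y := by
  obtain ⟨M, hM, hkernel⟩ := exists_radialKernel_le E
  set V := volume.real (closedBall (0 : E) 1) with hV_def
  have hV : 0 < V := ENNReal.toReal_pos (measure_closedBall_pos _ _ one_pos).ne'
    measure_closedBall_lt_top.ne
  refine ⟨M * V, by positivity, fun w x t ht hint hnonneg => ?_⟩
  calc radialMean w x t = ∫ y in closedBall x t, w y * radialKernel x t y :=
        radialMean_eq_setIntegral w x ht le_rfl
    _ ≤ ∫ y in closedBall x t, w y * ((t ^ finrank ℝ E)⁻¹ * M) := by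
        refine integral_mono_ae (integrableOn_mul_radialKernel hint) (hint.mul_const _) ?_
        filter_upwards [hnonneg] with y hy
        exact mul_le_mul_of_nonneg_left (hkernel x t ht y) hy
    _ = M * V * ⨍ y in closedBall x t, w y := by
        rw [integral_mul_const, setAverage_eq, Measure.addHaar_real_closedBall' _ _ ht.le,
          smul_eq_mul, ← hV_def]
        field_simp

theorem ae_tendsto_setAverage_closedBall (hU : IsOpen U) (hw : IntegrableOn w U) :
    ∀ᵐ x ∂volume.restrict U,
      Tendsto (fun t => ⨍ y in closedBall x t, w y) (𝓝[>] 0) (𝓝 (w x)) := by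
  have hind : LocallyIntegrable (U.indicator w) :=
    (hw.integrable_indicator hU.measurableSet).locallyIntegrable
  rw [ae_restrict_iff' hU.measurableSet]
  filter_upwards [(Besicovitch.vitaliFamily (volume : Measure E)).ae_tendsto_average hind]
    with x hx hxU
  obtain ⟨r, hr, hrU⟩ := Metric.nhds_basis_closedBall.mem_iff.1 (hU.mem_nhds hxU)
  rw [Set.indicator_of_mem hxU] at hx
  refine (hx.comp (Besicovitch.tendsto_filterAt volume x)).congr' ?_
  filter_upwards [Ioc_mem_nhdsGT hr] with t ht
  refine setAverage_congr_fun measurableSet_closedBall (Eventually.of_forall fun y hy => ?_)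
  exact Set.indicator_of_mem (hrU (closedBall_subset_closedBall ht.2 hy)) w

theorem WeaklySuperharmonicOn.exists_pos_le_of_setIntegral_pos (hw : WeaklySuperharmonicOn w U)
    (hδ : 0 < δ) (hU : closedBall x₀ (5 * δ) ⊆ U) (hint : IntegrableOn w (closedBall x₀ (5 * δ)))
    (hnonneg : ∀ᵐ y ∂volume.restrict (closedBall x₀ (5 * δ)), 0 ≤ w y)
    (hpos : 0 < ∫ y in ball x₀ δ, w y) :
    ∃ c > 0, ∀ᵐ x ∂volume.restrict (ball x₀ δ), c ≤ w x := by
  obtain ⟨M, hM, hmean⟩ := exists_radialMean_le_setAverage E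
  set a := ((3 * δ) ^ finrank ℝ E)⁻¹ * expNegInvGlue (5 / 9) * ∫ y in ball x₀ δ, w y
  have ha0 : 0 < a :=
    mul_pos (mul_pos (by positivity) (expNegInvGlue.pos_of_pos (by norm_num))) hpos
  refine ⟨a / M, by positivity, ?_⟩
  have hball : ball x₀ δ ⊆ closedBall x₀ (5 * δ) :=
    ball_subset_closedBall.trans (closedBall_subset_closedBall (by linarith))
  filter_upwards [ae_tendsto_setAverage_closedBall isOpen_ball (hint.mono_set hball),
    self_mem_ae_restrict measurableSet_ball] with x hlim hx
  have hsub {t : ℝ} (ht : t ≤ 4 * δ) : closedBall x t ⊆ closedBall x₀ (5 * δ) :=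
    closedBall_subset_closedBall' (by linarith [mem_ball.1 hx])
  have hintx {t : ℝ} (ht : t ≤ 4 * δ) := hint.mono_set (hsub ht)
  have hnonnegx {t : ℝ} (ht : t ≤ 4 * δ) :=
    ae_restrict_of_ae_restrict_of_subset (hsub ht) hnonneg
  rw [div_le_iff₀' hM]
  refine ge_of_tendsto (hlim.const_mul M) ?_
  filter_upwards [Ioc_mem_nhdsGT (by positivity : 0 < 3 * δ)] with t ht
  calc a ≤ radialMean w x (3 * δ) :=
        le_radialMean hδ (mem_ball.1 hx).le (hintx (by linarith)) (hnonnegx (by linarith))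
    _ ≤ radialMean w x t :=
        hw.antitoneOn_radialMean ((hsub le_rfl).trans hU) (hintx le_rfl)
          ⟨ht.1, by linarith [ht.2]⟩ ⟨by linarith, by linarith⟩ ht.2
    _ ≤ M * ⨍ y in closedBall x t, w y :=
        hmean w x t ht.1 (hintx (by linarith [ht.2])) (hnonnegx (by linarith [ht.2]))

theorem WeaklySuperharmonicOn.eventually_eq_zero_or_pos_le (hw : WeaklySuperharmonicOn w U)
    (hU : IsOpen U) (hloc : LocallyIntegrableOn w U) (hnonneg : ∀ᵐ x ∂volume.restrict U, 0 ≤ w x)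
    (hx₀ : x₀ ∈ U) :
    (∀ᶠ x in 𝓝 x₀ ⊓ ae volume, w x = 0) ∨ ∃ c > 0, ∀ᶠ x in 𝓝 x₀ ⊓ ae volume, c ≤ w x := by
  obtain ⟨r, hr, hrU⟩ := Metric.nhds_basis_closedBall.mem_iff.1 (hU.mem_nhds hx₀)
  obtain ⟨δ, hδ, rfl⟩ : ∃ δ > 0, r = 5 * δ := ⟨r / 5, by positivity, by ring⟩
  have hint := hloc.integrableOn_compact_subset hrU (isCompact_closedBall _ _)
  have hball : ball x₀ δ ⊆ closedBall x₀ (5 * δ) :=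
    ball_subset_closedBall.trans (closedBall_subset_closedBall (by linarith))
  have hnonneg_ball := ae_restrict_of_ae_restrict_of_subset (hball.trans hrU) hnonneg
  rcases (integral_nonneg_of_ae hnonneg_ball).eq_or_lt with hzero | hpos
  · exact Or.inl (eventually_nhds_inf_ae_of_ae_restrict (ball_mem_nhds x₀ hδ)
      ((integral_eq_zero_iff_of_nonneg_ae hnonneg_ball (hint.mono_set hball)).1 hzero.symm))
  · obtain ⟨c, hc, hcw⟩ := hw.exists_pos_le_of_setIntegral_pos hδ hrU hint
      (ae_restrict_of_ae_restrict_of_subset hrU hnonneg) hpos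
    exact Or.inr ⟨c, hc, eventually_nhds_inf_ae_of_ae_restrict (ball_mem_nhds x₀ hδ) hcw⟩

theorem WeaklySuperharmonicOn.strong_minimum_principle (hw : WeaklySuperharmonicOn w U)
    (hU : IsOpen U) (hconn : IsPreconnected U) (hloc : LocallyIntegrableOn w U)
    (hnonneg : ∀ᵐ x ∂volume.restrict U, 0 ≤ w x) :
    (∀ᵐ x ∂volume.restrict U, w x = 0) ∨
      ∀ x₀ ∈ U, ∃ c > 0, ∀ᶠ x in 𝓝 x₀ ⊓ ae volume, c ≤ w x := by
  set Z := {x₀ | ∀ᶠ x in 𝓝 x₀ ⊓ ae volume, w x = 0}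
  set P := {x₀ | ∃ c > 0, ∀ᶠ x in 𝓝 x₀ ⊓ ae volume, c ≤ w x}
  have hZ : IsOpen Z := isOpen_setOf_eventually_nhds_inf_ae
  have hP : IsOpen P := by
    refine isOpen_iff_mem_nhds.2 ?_
    rintro x₀ ⟨c, hc, hle⟩
    filter_upwards [isOpen_setOf_eventually_nhds_inf_ae.mem_nhds hle] with y hy using ⟨c, hc, hy⟩
  have hcover : U ⊆ Z ∪ P := fun x₀ hx₀ => hw.eventually_eq_zero_or_pos_le hU hloc hnonneg hx₀
  have hdisj : U ∩ (Z ∩ P) = ∅ := by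
    refine Set.eq_empty_iff_forall_notMem.2 ?_
    rintro x₀ ⟨-, (hzero : ∀ᶠ x in 𝓝 x₀ ⊓ ae volume, w x = 0), c, hc, hle⟩
    have := nhds_inf_ae_neBot (μ := volume) x₀
    obtain ⟨x, hx0, hcx⟩ := (hzero.and hle).exists
    linarith
  rcases isPreconnected_iff_subset_of_disjoint.1 hconn Z P hZ hP hcover hdisj with h | h
  · exact Or.inl (ae_restrict_of_forall_eventually_nhds_inf_ae hU.measurableSet h)
  · exact Or.inr h

end Superharmonic

section PunctureCutoff

variable {E : Type*} [NormedAddCommGroup E] [InnerProductSpace ℝ E] [FiniteDimensional ℝ E]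
  {φ : E → ℝ} {ε : ℝ} {x : E}

theorem exists_bound_derivatives_of_hasCompactSupport (hφ : ContDiff ℝ 2 φ)
    (hφc : HasCompactSupport φ) :
    ∃ B ≥ 0, ∀ x, |φ x| ≤ B ∧ ‖fderiv ℝ φ x‖ ≤ B ∧ |(Δ φ) x| ≤ B := by
  obtain ⟨B₀, hB₀⟩ := hφ.continuous.bounded_above_of_compact_support hφc
  obtain ⟨B₁, hB₁⟩ := (hφ.continuous_fderiv two_ne_zero).bounded_above_of_compact_support
    (hφc.fderiv ℝ)
  obtain ⟨B₂, hB₂⟩ := (continuous_laplacian hφ).bounded_above_of_compact_support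
    (HasCompactSupport.intro hφc fun _ => laplacian_eq_zero_of_notMem_tsupport)
  exact ⟨max B₀ (max B₁ B₂), le_max_of_le_left ((norm_nonneg _).trans (hB₀ 0)), fun x =>
    ⟨le_max_of_le_left (hB₀ x), le_max_of_le_right (le_max_of_le_left (hB₁ x)),
      le_max_of_le_right (le_max_of_le_right (hB₂ x))⟩⟩

/-- A fixed smooth bump about `0` with inner radius `1 / 2` and outer radius `1`, from which the
cutoffs at all scales are obtained by dilation. -/
noncomputable def unitBump (E : Type*) [NormedAddCommGroup E] : ContDiffBump (0 : E) :=
  ⟨1 / 2, 1, by norm_num, by norm_num⟩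

/-- A smooth cutoff excising the origin at scale `ε`: it vanishes on the ball of radius `ε / 2`
about `0` and equals `1` off the ball of radius `ε`. -/
noncomputable def punctureCutoff (ε : ℝ) (x : E) : ℝ :=
  1 - unitBump E (ε⁻¹ • x)

/-- The closed annulus `ε / 2 ≤ ‖x‖ ≤ ε`, outside of which `punctureCutoff ε` is locally
constant. -/
def annulus (E : Type*) [NormedAddCommGroup E] (ε : ℝ) : Set E :=
  closedBall 0 ε \ ball 0 (ε / 2)

theorem contDiff_punctureCutoff (ε : ℝ) : ContDiff ℝ ∞ (punctureCutoff (E := E) ε) :=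
  contDiff_const.sub ((unitBump E).contDiff.comp (contDiff_id.const_smul _))

theorem punctureCutoff_mem_Icc (ε : ℝ) (x : E) : punctureCutoff ε x ∈ Set.Icc 0 1 :=
  ⟨sub_nonneg.2 (unitBump E).le_one, sub_le_self _ (unitBump E).nonneg⟩

theorem punctureCutoff_eq_zero (hε : 0 < ε) (hx : ‖x‖ ≤ ε / 2) : punctureCutoff ε x = 0 := by
  refine sub_eq_zero.2 ((unitBump E).one_of_mem_closedBall ?_).symm
  rw [mem_closedBall_zero_iff, norm_smul, norm_inv, Real.norm_of_nonneg hε.le,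
    inv_mul_le_iff₀ hε]
  exact hx.trans_eq (div_eq_mul_one_div _ _)

theorem punctureCutoff_eq_one (hε : 0 < ε) (hx : ε ≤ ‖x‖) : punctureCutoff ε x = 1 := by
  refine sub_eq_self.2 ((unitBump E).zero_of_le_dist ?_)
  rw [dist_zero_right, norm_smul, norm_inv, Real.norm_of_nonneg hε.le, le_inv_mul_iff₀ hε]
  exact (mul_one ε).trans_le hx

theorem exists_eventuallyEq_punctureCutoff_const (hε : 0 < ε) (hx : x ∉ annulus E ε) :
    ∃ c : ℝ, punctureCutoff ε =ᶠ[𝓝 x] fun _ => c := by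
  by_cases hxε : x ∈ closedBall 0 ε
  · have hx' : x ∈ ball 0 (ε / 2) := not_not.1 fun h => hx ⟨hxε, h⟩
    refine ⟨0, ?_⟩
    filter_upwards [isOpen_ball.mem_nhds hx'] with y hy
    exact punctureCutoff_eq_zero hε (mem_ball_zero_iff.1 hy).le
  · refine ⟨1, ?_⟩
    filter_upwards [isClosed_closedBall.isOpen_compl.mem_nhds hxε] with y hy
    exact punctureCutoff_eq_one hε (not_le.1 (hy ∘ mem_closedBall_zero_iff.2)).le

theorem tsupport_mul_punctureCutoff_subset (hε : 0 < ε) :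
    tsupport (fun x => φ x * punctureCutoff ε x) ⊆ tsupport φ \ {0} := by
  refine fun x hx => ⟨tsupport_mul_subset_left hx, ?_⟩
  rintro rfl
  refine notMem_tsupport_iff_eventuallyEq.2 ?_ hx
  filter_upwards [ball_mem_nhds (0 : E) (half_pos hε)] with y hy
  rw [punctureCutoff_eq_zero hε (mem_ball_zero_iff.1 hy).le, mul_zero, Pi.zero_apply]

theorem fderiv_punctureCutoff (ε : ℝ) (x : E) :
    fderiv ℝ (punctureCutoff ε) x = -(ε⁻¹ • fderiv ℝ (unitBump E) (ε⁻¹ • x)) := by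
  unfold punctureCutoff
  rw [fderiv_const_sub, fderiv_comp_smul]

theorem laplacian_punctureCutoff (ε : ℝ) (x : E) :
    (Δ (punctureCutoff ε : E → ℝ)) x = -(ε⁻¹ ^ 2 * (Δ ⇑(unitBump E)) (ε⁻¹ • x)) := by
  rw [← laplacian_comp_smul (unitBump E).contDiff]
  have hsmooth : ContDiff ℝ 2 fun y => (unitBump E) (ε⁻¹ • y) :=
    (unitBump E).contDiff.comp (contDiff_id.const_smul _)
  refine ((contDiff_const (c := (1 : ℝ))).contDiffAt.laplacian_sub hsmooth.contDiffAt).trans ?_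
  rw [InnerProductSpace.laplacian_const, Pi.zero_apply, zero_sub]

theorem exists_bound_derivatives_punctureCutoff (E : Type*) [NormedAddCommGroup E]
    [InnerProductSpace ℝ E] [FiniteDimensional ℝ E] :
    ∃ D ≥ 0, ∀ ε > 0, ∀ x : E, |(Δ (punctureCutoff ε : E → ℝ)) x| ≤ ε⁻¹ ^ 2 * D ∧
      ‖∇ (punctureCutoff ε : E → ℝ) x‖ ≤ ε⁻¹ * D := by
  obtain ⟨D, hD0, hD⟩ := exists_bound_derivatives_of_hasCompactSupport
    (unitBump E).contDiff (unitBump E).hasCompactSupport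
  refine ⟨D, hD0, fun ε hε x => ⟨?_, ?_⟩⟩
  · rw [laplacian_punctureCutoff, abs_neg, abs_mul, abs_of_nonneg (by positivity)]
    gcongr
    exact (hD _).2.2
  · rw [norm_gradient_eq_norm_fderiv, fderiv_punctureCutoff, norm_neg, norm_smul,
      Real.norm_of_nonneg (by positivity)]
    gcongr
    exact (hD _).2.1

theorem laplacian_and_gradient_punctureCutoff_eq_zero (hε : 0 < ε) (hx : x ∉ annulus E ε) :
    (Δ (punctureCutoff ε : E → ℝ)) x = 0 ∧ ∇ (punctureCutoff ε) x = 0 := by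
  obtain ⟨c, hc⟩ := exists_eventuallyEq_punctureCutoff_const hε hx
  rw [(InnerProductSpace.laplacian_congr_nhds hc).eq_of_nhds, hc.gradient_eq, gradient_fun_const]
  exact ⟨congrFun InnerProductSpace.laplacian_const x, rfl⟩

theorem exists_bound_laplacian_mul_punctureCutoff (hφ : ContDiff ℝ 2 φ)
    (hφc : HasCompactSupport φ) :
    ∃ A ≥ 0, ∀ ε ∈ Set.Ioc (0 : ℝ) 1, ∀ x,
      |(Δ fun y => φ y * punctureCutoff ε y) x - punctureCutoff ε x * (Δ φ) x|
        ≤ (annulus E ε).indicator (fun x => A / ‖x‖ ^ 2) x := by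
  obtain ⟨B, hB0, hB⟩ := exists_bound_derivatives_of_hasCompactSupport hφ hφc
  obtain ⟨D, hD0, hD⟩ := exists_bound_derivatives_punctureCutoff E
  refine ⟨3 * B * D, by positivity, fun ε hε x => ?_⟩
  rw [laplacian_mul hφ.contDiffAt ((contDiff_punctureCutoff ε).of_le
    (WithTop.coe_le_coe.2 le_top)).contDiffAt, add_sub_cancel_right]
  by_cases hx : x ∈ annulus E ε
  · have hε0 : 0 < ε := hε.1
    have hxε : ‖x‖ ≤ ε := mem_closedBall_zero_iff.1 hx.1
    have hx0 : 0 < ‖x‖ := (half_pos hε0).trans_le (not_lt.1 (hx.2 ∘ mem_ball_zero_iff.2))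
    have hscale : ε⁻¹ ≤ ε⁻¹ ^ 2 := le_self_pow₀ ((one_le_inv₀ hε0).2 hε.2) two_ne_zero
    rw [Set.indicator_of_mem hx]
    calc |φ x * (Δ (punctureCutoff ε : E → ℝ)) x + 2 * inner ℝ (∇ φ x) (∇ (punctureCutoff ε) x)|
        ≤ |φ x| * |(Δ (punctureCutoff ε : E → ℝ)) x|
            + 2 * (‖∇ φ x‖ * ‖∇ (punctureCutoff ε) x‖) := by
          refine (abs_add_le _ _).trans ?_
          rw [abs_mul, abs_mul, abs_two]
          gcongr
          exact abs_real_inner_le_norm _ _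
      _ ≤ B * (ε⁻¹ ^ 2 * D) + 2 * (B * (ε⁻¹ ^ 2 * D)) := by
          gcongr
          · exact (hB x).1
          · exact (hD ε hε0 x).1
          · exact norm_gradient_eq_norm_fderiv.trans_le (hB x).2.1
          · exact (hD ε hε0 x).2.trans (by gcongr)
      _ = 3 * B * D / ε ^ 2 := by ring
      _ ≤ 3 * B * D / ‖x‖ ^ 2 := by gcongr
  · obtain ⟨hΔ, hgrad⟩ := laplacian_and_gradient_punctureCutoff_eq_zero hε.1 hx
    rw [Set.indicator_of_notMem hx, hΔ, hgrad, inner_zero_right, mul_zero, mul_zero, add_zero,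
      abs_zero]

theorem exists_bound_mul_laplacian_mul_punctureCutoff (hφ : ContDiff ℝ 2 φ)
    (hφc : HasCompactSupport φ) :
    ∃ A ≥ 0, ∀ ε ∈ Set.Ioc (0 : ℝ) 1, ∀ (w : E → ℝ) (x : E),
      ‖w x * (Δ fun y => φ y * punctureCutoff ε y) x‖
        ≤ ‖w x * (Δ φ) x‖ + A * (annulus E ε).indicator (fun x => ‖w x / ‖x‖ ^ 2‖) x := by
  obtain ⟨A, hA0, hA⟩ := exists_bound_laplacian_mul_punctureCutoff hφ hφc
  refine ⟨A, hA0, fun ε hε w x => ?_⟩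
  have hζ := punctureCutoff_mem_Icc ε x
  have hmain : |punctureCutoff ε x * (Δ φ) x| ≤ |(Δ φ) x| := by
    rw [abs_mul, abs_of_nonneg hζ.1]
    exact mul_le_of_le_one_left (abs_nonneg _) hζ.2
  calc ‖w x * (Δ fun y => φ y * punctureCutoff ε y) x‖
      ≤ |w x| * (|(Δ φ) x| + (annulus E ε).indicator (fun x => A / ‖x‖ ^ 2) x) := by
        rw [Real.norm_eq_abs, abs_mul]
        gcongr
        linarith [abs_sub_abs_le_abs_sub ((Δ fun y => φ y * punctureCutoff ε y) x)
          (punctureCutoff ε x * (Δ φ) x), hA ε hε x]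
    _ = ‖w x * (Δ φ) x‖ + A * (annulus E ε).indicator (fun x => ‖w x / ‖x‖ ^ 2‖) x := by
        by_cases hx : x ∈ annulus E ε
        · simp only [Set.indicator_of_mem hx, norm_mul, norm_div, norm_pow, Real.norm_eq_abs,
            abs_norm]
          ring
        · simp only [Set.indicator_of_notMem hx, norm_mul, Real.norm_eq_abs, add_zero, mul_zero]

end PunctureCutoff

section RemovableSingularity

variable {E : Type*} [NormedAddCommGroup E] [MeasurableSpace E] {μ : Measure E}
  {w g φ : E → ℝ} {U K : Set E}

theorem locallyIntegrableOn_of_sdiff_singleton (hw : LocallyIntegrableOn w (U \ {0}) μ)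
    (hzero : IntegrableAtFilter w (𝓝 0) μ) : LocallyIntegrableOn w U μ := by
  intro x hx
  rcases eq_or_ne x 0 with rfl | hx0
  · exact hzero.filter_mono nhdsWithin_le_nhds
  · have hpunctured : 𝓝[U \ {0}] x = 𝓝[U] x :=
      nhdsWithin_inter_of_mem' (mem_nhdsWithin_of_mem_nhds (isOpen_ne.mem_nhds hx0))
    exact hpunctured ▸ hw x ⟨hx, hx0⟩

variable [BorelSpace E]

theorem integrable_mul_of_locallyIntegrableOn (hw : LocallyIntegrableOn w U μ) (hg : Continuous g)
    (hK : IsCompact K) (hKU : K ⊆ U) (hgK : ∀ x ∉ K, g x = 0) :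
    Integrable (fun x => w x * g x) μ := by
  refine (integrableOn_iff_integrable_of_support_subset fun x hx => ?_).1
    ((hw.integrableOn_compact_subset hKU hK).mul_continuousOn hg.continuousOn hK)
  exact not_imp_comm.1 (hgK x) (right_ne_zero_of_mul hx)

theorem integrableAtFilter_of_div_norm_sq [ProperSpace E] [NullSingletonClass μ]
    (hw : IntegrableAtFilter (fun x => w x / ‖x‖ ^ 2) (𝓝 0) μ) :
    IntegrableAtFilter w (𝓝 0) μ := by
  obtain ⟨s, hs, hint⟩ := hw
  obtain ⟨r, hr, hrs⟩ := Metric.nhds_basis_closedBall.mem_iff.1 hs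
  refine ⟨closedBall 0 r, closedBall_mem_nhds _ hr, ?_⟩
  refine ((hint.mono_set hrs).mul_continuousOn (continuous_norm.pow 2).continuousOn
    (isCompact_closedBall 0 r)).congr (ae_restrict_of_ae ?_)
  filter_upwards [Measure.ae_ne μ (0 : E)] with x hx
  exact div_mul_cancel₀ _ (pow_ne_zero 2 (norm_ne_zero_iff.2 hx))

variable [InnerProductSpace ℝ E] [FiniteDimensional ℝ E]

theorem tendsto_integral_mul_laplacian_mul_punctureCutoff [NullSingletonClass μ]
    (hloc : LocallyIntegrableOn w U μ)
    (hdiv : IntegrableAtFilter (fun x => w x / ‖x‖ ^ 2) (𝓝 0) μ) (hφ : ContDiff ℝ ∞ φ)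
    (hφc : HasCompactSupport φ) (hφU : tsupport φ ⊆ U) :
    Tendsto (fun ε => ∫ x, w x * (Δ fun y => φ y * punctureCutoff ε y) x ∂μ) (𝓝[>] 0)
      (𝓝 (∫ x, w x * (Δ φ) x ∂μ)) := by
  have hφ2 : ContDiff ℝ 2 φ := hφ.of_le (WithTop.coe_le_coe.2 le_top)
  obtain ⟨A, hA0, hA⟩ := exists_bound_mul_laplacian_mul_punctureCutoff hφ2 hφc
  obtain ⟨s, hs, hdiv⟩ := hdiv
  obtain ⟨r, hr, hrs⟩ := Metric.nhds_basis_closedBall.mem_iff.1 hs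
  have hdivr := (integrable_indicator_iff measurableSet_closedBall).2 (hdiv.mono_set hrs).norm
  refine tendsto_integral_filter_of_dominated_convergence
    (fun x => ‖w x * (Δ φ) x‖ + A * (closedBall 0 r).indicator (fun x => ‖w x / ‖x‖ ^ 2‖) x)
    (Eventually.of_forall fun ε => ?_) ?_ ?_ ?_
  · have hφζ : ContDiff ℝ 2 fun y => φ y * punctureCutoff ε y :=
      hφ2.mul ((contDiff_punctureCutoff ε).of_le (WithTop.coe_le_coe.2 le_top))
    exact (integrable_mul_of_locallyIntegrableOn hloc (continuous_laplacian hφζ) hφc hφU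
      fun x hx => laplacian_eq_zero_of_notMem_tsupport fun h => hx (tsupport_mul_subset_left h)
      ).aestronglyMeasurable
  · filter_upwards [Ioc_mem_nhdsGT one_pos, Ioc_mem_nhdsGT hr] with ε hε hεr
    refine Eventually.of_forall fun x => (hA ε hε w x).trans ?_
    have hsub : annulus E ε ⊆ closedBall 0 r :=
      Set.sdiff_subset.trans (closedBall_subset_closedBall hεr.2)
    gcongr
  · exact (integrable_mul_of_locallyIntegrableOn hloc (continuous_laplacian hφ2) hφc hφU
      fun x hx => laplacian_eq_zero_of_notMem_tsupport hx).norm.add (hdivr.const_mul A)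
  · filter_upwards [Measure.ae_ne μ (0 : E)] with x hx
    refine tendsto_const_nhds.congr' ?_
    filter_upwards [Ioo_mem_nhdsGT (norm_pos_iff.2 hx)] with ε hε
    have hφζ : (fun y => φ y * punctureCutoff ε y) =ᶠ[𝓝 x] φ := by
      filter_upwards [(isOpen_lt continuous_const continuous_norm).mem_nhds hε.2] with y hy
      rw [punctureCutoff_eq_one hε.1 (le_of_lt hy), mul_one]
    rw [(InnerProductSpace.laplacian_congr_nhds hφζ).eq_of_nhds]

theorem WeaklySuperharmonicOn.of_sdiff_singleton [Nontrivial E]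
    (hw : WeaklySuperharmonicOn w (U \ {0})) (hloc : LocallyIntegrableOn w U)
    (hdiv : IntegrableAtFilter (fun x => w x / ‖x‖ ^ 2) (𝓝 0)) : WeaklySuperharmonicOn w U := by
  intro φ hφ hφc hφU hφ0
  refine le_of_tendsto
    (tendsto_integral_mul_laplacian_mul_punctureCutoff hloc hdiv hφ hφc hφU) ?_
  filter_upwards [self_mem_nhdsWithin] with ε hε
  exact hw _ (hφ.mul (contDiff_punctureCutoff ε)) hφc.mul_right
    ((tsupport_mul_punctureCutoff_subset hε).trans (Set.sdiff_subset_sdiff_left hφU))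
    fun x => mul_nonneg (hφ0 x) (punctureCutoff_mem_Icc ε x).1

theorem inv_pow_mul_volume_annulus_le {ε : ℝ} (hε : 0 < ε) :
    ((ε / 2) ^ finrank ℝ E)⁻¹ * volume.real (annulus E ε)
      ≤ 2 ^ finrank ℝ E * volume.real (closedBall (0 : E) 1) := by
  calc ((ε / 2) ^ finrank ℝ E)⁻¹ * volume.real (annulus E ε)
      ≤ ((ε / 2) ^ finrank ℝ E)⁻¹ * volume.real (closedBall (0 : E) ε) := by
        gcongr
        · exact measure_closedBall_lt_top.ne
        · exact Set.sdiff_subset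
    _ = 2 ^ finrank ℝ E * volume.real (closedBall (0 : E) 1) := by
        rw [Measure.addHaar_real_closedBall' _ _ hε.le, div_pow]
        field_simp

theorem exists_bound_on_annulus {f : E → ℝ}
    (hf : f =O[𝓝 0 ⊓ ae volume] fun x => (‖x‖ ^ finrank ℝ E)⁻¹) :
    ∃ C ≥ 0, ∀ᶠ ε in 𝓝[>] 0, ∀ᵐ x, x ∈ annulus E ε → ‖f x‖ ≤ C * ((ε / 2) ^ finrank ℝ E)⁻¹ := by
  obtain ⟨C, hC, hbound⟩ := hf.exists_nonneg
  obtain ⟨u, hu, hu0, hbound⟩ := exists_isOpen_ae_of_eventually_nhds_inf_ae hbound.bound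
  obtain ⟨r, hr, hru⟩ := Metric.nhds_basis_closedBall.mem_iff.1 (hu.mem_nhds hu0)
  refine ⟨C, hC, ?_⟩
  filter_upwards [Ioc_mem_nhdsGT hr] with ε hε
  filter_upwards [hbound] with x hx hxε
  have hε0 : 0 < ε / 2 := half_pos hε.1
  have hnorm : ε / 2 ≤ ‖x‖ := not_lt.1 (hxε.2 ∘ mem_ball_zero_iff.2)
  refine (hx (hru (closedBall_subset_closedBall hε.2 hxε.1))).trans ?_
  rw [Real.norm_of_nonneg (by positivity)]
  gcongr

theorem exists_bound_integral_mul_laplacian_mul_punctureCutoff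
    (hloc : LocallyIntegrableOn w (U \ {0}))
    (hgrowth : (fun x => w x / ‖x‖ ^ 2) =O[𝓝 0 ⊓ ae volume] fun x => (‖x‖ ^ finrank ℝ E)⁻¹)
    (hφ : ContDiff ℝ 2 φ) (hφc : HasCompactSupport φ) (hφU : tsupport φ ⊆ U)
    (hΔφ : ∀ᶠ x in 𝓝 0, (Δ φ) x = 0) :
    ∃ M, ∀ᶠ ε in 𝓝[>] 0, |∫ x, w x * (Δ fun y => φ y * punctureCutoff ε y) x| ≤ M := by
  obtain ⟨A, hA0, hA⟩ := exists_bound_mul_laplacian_mul_punctureCutoff hφ hφc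
  obtain ⟨C, hC0, hC⟩ := exists_bound_on_annulus hgrowth
  obtain ⟨δ, hδ, hΔδ⟩ := Metric.eventually_nhds_iff_ball.1 hΔφ
  have hint : Integrable fun x => w x * (Δ φ) x := by
    refine integrable_mul_of_locallyIntegrableOn hloc (continuous_laplacian hφ)
      (hφc.isCompact.diff (isOpen_ball (x := 0) (ε := δ)))
      (Set.sdiff_subset_sdiff hφU (Set.singleton_subset_iff.2 (mem_ball_self hδ))) fun x hx => ?_
    by_cases hxδ : x ∈ ball 0 δ
    · exact hΔδ x hxδ
    · exact laplacian_eq_zero_of_notMem_tsupport fun h => hx ⟨h, hxδ⟩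
  refine ⟨(∫ x, ‖w x * (Δ φ) x‖)
    + A * (C * (2 ^ finrank ℝ E * volume.real (closedBall (0 : E) 1))), ?_⟩
  filter_upwards [Ioc_mem_nhdsGT one_pos, hC] with ε hε hCε
  set c := C * ((ε / 2) ^ finrank ℝ E)⁻¹ with hc
  have hannulus : MeasurableSet (annulus E ε) := measurableSet_closedBall.diff measurableSet_ball
  have hconst : Integrable ((annulus E ε).indicator fun _ => c) :=
    (integrable_indicator_iff hannulus).2 (integrableOn_const
      (measure_lt_top_of_subset Set.sdiff_subset measure_closedBall_lt_top.ne).ne)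
  calc |∫ x, w x * (Δ fun y => φ y * punctureCutoff ε y) x|
      ≤ ∫ x, ‖w x * (Δ φ) x‖ + A * (annulus E ε).indicator (fun _ => c) x := by
        rw [← Real.norm_eq_abs]
        refine norm_integral_le_of_norm_le (hint.norm.add (hconst.const_mul A)) ?_
        filter_upwards [hCε] with x hx
        refine (hA ε hε w x).trans ?_
        gcongr _ + A * ?_
        exact Set.indicator_le_indicator' (g := fun _ => c) hx
    _ = (∫ x, ‖w x * (Δ φ) x‖)
          + A * (C * (((ε / 2) ^ finrank ℝ E)⁻¹ * volume.real (annulus E ε))) := by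
        rw [integral_add hint.norm (hconst.const_mul A), integral_const_mul,
          integral_indicator_const _ hannulus, smul_eq_mul, hc]
        ring
    _ ≤ _ := by
        gcongr _ + A * (C * ?_)
        exact inv_pow_mul_volume_annulus_le hε.1

end RemovableSingularity

section IntegrabilityCriteria

variable {X : Type*} [MeasurableSpace X] {μ : Measure X} {h f g : X → ℝ}

theorem ae_pos_of_lintegral_inv_ofReal_ne_top (hh : AEMeasurable h μ)
    (hfin : ∫⁻ x, (ENNReal.ofReal (h x))⁻¹ ∂μ ≠ ⊤) : ∀ᵐ x ∂μ, 0 < h x := by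
  filter_upwards [ae_lt_top' hh.ennreal_ofReal.inv hfin] with x hx
  exact ENNReal.ofReal_pos.1 (ENNReal.inv_lt_top.1 hx)

theorem integrable_inv_of_lintegral_inv_ofReal_ne_top (hh : AEMeasurable h μ)
    (hfin : ∫⁻ x, (ENNReal.ofReal (h x))⁻¹ ∂μ ≠ ⊤) : Integrable (fun x => (h x)⁻¹) μ := by
  refine (integrable_toReal_of_lintegral_ne_top hh.ennreal_ofReal.inv hfin).congr ?_
  filter_upwards [ae_pos_of_lintegral_inv_ofReal_ne_top hh hfin] with x hx
  rw [Pi.inv_apply, ENNReal.toReal_inv, ENNReal.toReal_ofReal hx.le]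

theorem integrableAtFilter_of_mul_of_pos_le {l : Filter X} [l.IsMeasurablyGenerated] {c : ℝ}
    (hf : StronglyMeasurableAtFilter f (l ⊓ ae μ) μ)
    (hfg : IntegrableAtFilter (fun x => f x * g x) l μ) (hc : 0 < c)
    (hg : ∀ᶠ x in l ⊓ ae μ, c ≤ g x) : IntegrableAtFilter f l μ := by
  rw [← IntegrableAtFilter.inf_ae_iff] at hfg ⊢
  refine Asymptotics.IsBigO.integrableAtFilter (.of_bound c⁻¹ ?_) hf hfg
  filter_upwards [hg] with x hx
  rw [norm_mul, inv_mul_eq_div, le_div_iff₀ hc]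
  gcongr
  exact hx.trans (le_abs_self _)

end IntegrabilityCriteria

section WeightsNearZero

variable {E : Type*} [NormedAddCommGroup E] {W w : E → ℝ} {U : Set E}

theorem isBigO_div_norm_sq {l : Filter E} {n : ℕ}
    (hw : w =O[l] fun x => ‖x‖ ^ (2 - (n : ℤ))) :
    (fun x => w x / ‖x‖ ^ 2) =O[l] fun x => (‖x‖ ^ n)⁻¹ := by
  simp only [div_eq_mul_inv]
  refine (hw.mul (Asymptotics.isBigO_refl (fun x => (‖x‖ ^ 2)⁻¹) l)).trans
    (Asymptotics.isBigO_of_le l fun x => ?_)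
  rcases eq_or_ne x 0 with rfl | hx
  · simp
  · have hx' : ‖x‖ ≠ 0 := norm_ne_zero_iff.2 hx
    rw [zpow_sub₀ hx', zpow_natCast, zpow_ofNat]
    field_simp
    rfl

variable [MeasurableSpace E] [OpensMeasurableSpace E] {μ : Measure E} [NullSingletonClass μ]

theorem aecover_compl_ball {ι : Type*} {l : Filter ι} {ε : ι → ℝ} (hε : Tendsto ε l (𝓝 0)) :
    AECover μ l fun k => (ball (0 : E) (ε k))ᶜ := by
  refine ⟨?_, fun k => measurableSet_ball.compl⟩
  filter_upwards [Measure.ae_ne μ 0] with x hx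
  filter_upwards [hε.eventually_lt_const (norm_pos_iff.2 hx)] with k hk
  exact fun h => hk.not_gt (mem_ball_zero_iff.1 h)

theorem eventually_pos_and_integrableAtFilter_inv {d : ℕ} (hU : U ∈ 𝓝 0)
    (hW : AEStronglyMeasurable W (μ.restrict (U \ {0})))
    (hinv : ∃ r : ℝ, 0 < r ∧
      ∫⁻ x in ball (0 : E) r, (ENNReal.ofReal (‖x‖ ^ d * W x))⁻¹ ∂μ < ⊤) :
    (∀ᶠ x in 𝓝 0 ⊓ ae μ, 0 < W x) ∧
      IntegrableAtFilter (fun x => (‖x‖ ^ d * W x)⁻¹) (𝓝 0) μ := by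
  obtain ⟨r, hr, hfin⟩ := hinv
  have hmem : ball 0 r ∩ U ∈ 𝓝 (0 : E) := inter_mem (ball_mem_nhds 0 hr) hU
  have hfin' : ∫⁻ x in ball 0 r ∩ U, (ENNReal.ofReal (‖x‖ ^ d * W x))⁻¹ ∂μ ≠ ⊤ :=
    ((lintegral_mono_set Set.inter_subset_left).trans_lt hfin).ne
  rw [Measure.restrict_congr_set (sdiff_null_ae_eq_self (measure_singleton 0))] at hW
  have hh : AEMeasurable (fun x => ‖x‖ ^ d * W x) (μ.restrict (ball 0 r ∩ U)) :=
    AEMeasurable.mul (by fun_prop) (hW.mono_set Set.inter_subset_right).aemeasurable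
  refine ⟨eventually_nhds_inf_ae_of_ae_restrict hmem ?_,
    _, hmem, integrable_inv_of_lintegral_inv_ofReal_ne_top hh hfin'⟩
  filter_upwards [ae_pos_of_lintegral_inv_ofReal_ne_top hh hfin'] with x hx
  exact pos_of_mul_pos_right hx (by positivity)

theorem div_sq_le_add_inv {r V u C : ℝ} {d : ℕ} (hV : 0 < V) (hu : 0 ≤ u) (hC : 0 ≤ C)
    (hr : 0 < r) (hgrowth : u / r ^ 2 ≤ C * (r ^ d)⁻¹) :
    u / r ^ 2 ≤ C * (V * u) + (r ^ (d + 2) * V)⁻¹ := by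
  refine (abs_le_of_sq_le_sq' ?_ (by positivity)).2
  calc (u / r ^ 2) ^ 2 ≤ u / r ^ 2 * (C * (r ^ d)⁻¹) := by
        rw [sq]
        gcongr
    _ = C * (V * u) * (r ^ (d + 2) * V)⁻¹ := by
        field_simp
        ring
    _ ≤ (C * (V * u) + (r ^ (d + 2) * V)⁻¹) ^ 2 := by
        have hinv : 0 ≤ (r ^ (d + 2) * V)⁻¹ := by positivity
        have hVu : 0 ≤ C * (V * u) := by positivity
        nlinarith [mul_nonneg hVu hinv]

theorem integrableAtFilter_div_norm_sq {d : ℕ} (hU : U ∈ 𝓝 0)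
    (hw_meas : AEStronglyMeasurable w (μ.restrict (U \ {0})))
    (hWw : IntegrableAtFilter (fun x => W x * w x) (𝓝 0) μ)
    (hinv : IntegrableAtFilter (fun x => (‖x‖ ^ (d + 2) * W x)⁻¹) (𝓝 0) μ)
    (hW_pos : ∀ᶠ x in 𝓝 0 ⊓ ae μ, 0 < W x) (hw_nonneg : ∀ᶠ x in 𝓝 0 ⊓ ae μ, 0 ≤ w x)
    (hgrowth : (fun x => w x / ‖x‖ ^ 2) =O[𝓝 0 ⊓ ae μ] fun x => (‖x‖ ^ d)⁻¹) :
    IntegrableAtFilter (fun x => w x / ‖x‖ ^ 2) (𝓝 0) μ := by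
  have hpunctured : U \ {0} ∈ 𝓝 0 ⊓ ae μ := sdiff_singleton_mem_nhds_inf_ae hU
  obtain ⟨C, hC, hbound⟩ := hgrowth.exists_nonneg
  rw [← IntegrableAtFilter.inf_ae_iff] at hWw hinv ⊢
  have hmajorant := (hWw.smul C).add hinv
  refine Asymptotics.IsBigO.integrableAtFilter (.of_bound 1 ?_) ⟨_, hpunctured, ?_⟩ hmajorant
  · filter_upwards [hbound.bound, hW_pos, hw_nonneg, hpunctured] with x hx hWx hwx hx0
    have hx_pos : 0 < ‖x‖ := norm_pos_iff.2 hx0.2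
    have hmaj : 0 ≤ C * (W x * w x) + (‖x‖ ^ (d + 2) * W x)⁻¹ := by positivity
    rw [Real.norm_of_nonneg (by positivity), Real.norm_of_nonneg (by positivity)] at hx
    rw [one_mul, Real.norm_of_nonneg (by positivity)]
    exact (div_sq_le_add_inv hWx hwx hC hx_pos hx).trans (le_abs_self _)
  · exact (hw_meas.aemeasurable.div (by fun_prop)).aestronglyMeasurable

end WeightsNearZero

section Schrodinger

variable {n : ℕ} {W w φ : EuclideanSpace ℝ (Fin n) → ℝ} {U S : Set (EuclideanSpace ℝ (Fin n))}

theorem MemLinftyLoc.locallyIntegrableOn_mul (hW : MemLinftyLoc W U) (hU : IsOpen U)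
    (hw : LocallyIntegrableOn w U) : LocallyIntegrableOn (fun x => W x * w x) U :=
  (locallyIntegrableOn_iff hU.isLocallyClosed).2 fun K hKU hK =>
    (hw.integrableOn_compact_subset hKU hK).mul_of_top_right (hW K hKU hK)

theorem MemLinftyLoc.aestronglyMeasurable (hW : MemLinftyLoc W U) (hU : IsOpen U) :
    AEStronglyMeasurable W (volume.restrict U) := by
  simpa only [mul_one] using (hW.locallyIntegrableOn_mul hU
    ((locallyIntegrable_const 1).locallyIntegrableOn U)).aestronglyMeasurable

theorem IsWeakSolution.neg (hw : IsWeakSolution W w U) : IsWeakSolution W (fun x => -w x) U := by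
  intro φ hφ hφc hφU
  simpa only [neg_mul, mul_neg, integral_neg, neg_inj] using hw φ hφ hφc hφU

theorem IsWeakSolution.integral_mul_laplacian (hw : IsWeakSolution W w U) (hφ : ContDiff ℝ ∞ φ)
    (hφc : HasCompactSupport φ) (hφU : tsupport φ ⊆ U) :
    ∫ x, w x * (Δ φ) x = -∫ x in U, W x * w x * φ x := by
  rw [← hw φ hφ hφc hφU, ← integral_neg,
    setIntegral_eq_integral_of_forall_compl_eq_zero fun x hx => ?_]
  · simp only [mul_neg, neg_neg]
  · rw [laplacian_eq_zero_of_notMem_tsupport (Set.notMem_subset hφU hx), neg_zero, mul_zero,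
      neg_zero]

theorem IsWeakSolution.weaklySuperharmonicOn (hw : IsWeakSolution W w U)
    (hWw : ∀ᵐ x ∂volume.restrict U, 0 ≤ W x * w x) : WeaklySuperharmonicOn w U := by
  intro φ hφ hφc hφU hφ0
  rw [hw.integral_mul_laplacian hφ hφc hφU, neg_nonpos]
  refine integral_nonneg_of_ae ?_
  filter_upwards [hWw] with x hx using mul_nonneg hx (hφ0 x)

theorem IsWeakSolution.setIntegral_norm_mul_le (hw : IsWeakSolution W w U) (hU : IsOpen U)
    (hW_loc : MemLinftyLoc W U) (hw_loc : LocallyIntegrableOn w U)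
    (hWw : ∀ᵐ x ∂volume.restrict U, 0 ≤ W x * w x) (hφ : ContDiff ℝ ∞ φ)
    (hφc : HasCompactSupport φ) (hφU : tsupport φ ⊆ U) (hφ0 : ∀ x, 0 ≤ φ x)
    (hS : MeasurableSet S) (hSU : S ⊆ U) (hφS : ∀ x ∈ S, φ x = 1) :
    ∫ x in S, ‖W x * w x‖ ≤ |∫ x, w x * (Δ φ) x| := by
  have hint : Integrable fun x => W x * w x * φ x :=
    integrable_mul_of_locallyIntegrableOn (hW_loc.locallyIntegrableOn_mul hU hw_loc)
      hφ.continuous hφc hφU fun x hx => image_eq_zero_of_notMem_tsupport hx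
  calc ∫ x in S, ‖W x * w x‖ = ∫ x in S, W x * w x * φ x := by
        refine integral_congr_ae ?_
        filter_upwards [ae_restrict_of_ae_restrict_of_subset hSU hWw, self_mem_ae_restrict hS]
          with x hx hxS
        rw [Real.norm_of_nonneg hx, hφS x hxS, mul_one]
    _ ≤ ∫ x in U, W x * w x * φ x := by
        refine setIntegral_mono_set hint.integrableOn ?_ (Eventually.of_forall hSU)
        filter_upwards [hWw] with x hx using mul_nonneg hx (hφ0 x)
    _ ≤ _ := by
        rw [hw.integral_mul_laplacian hφ hφc hφU, abs_neg]
        exact le_abs_self (∫ x in U, W x * w x * φ x)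

theorem IsWeakSolution.integrableAtFilter_mul [Nonempty (Fin n)]
    (hw : IsWeakSolution W w (U \ {0})) (hU : IsOpen U) (h0 : 0 ∈ U)
    (hW_loc : MemLinftyLoc W (U \ {0})) (hw_loc : LocallyIntegrableOn w (U \ {0}))
    (hWw : ∀ᵐ x ∂volume.restrict (U \ {0}), 0 ≤ W x * w x)
    (hgrowth : (fun x => w x / ‖x‖ ^ 2) =O[𝓝 0 ⊓ ae volume] fun x => (‖x‖ ^ n)⁻¹) :
    IntegrableAtFilter (fun x => W x * w x) (𝓝 0) := by
  have hV : IsOpen (U \ {0}) := hU.sdiff isClosed_singleton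
  obtain ⟨r, hr, hrU⟩ := Metric.nhds_basis_closedBall.mem_iff.1 (hU.mem_nhds h0)
  let φ : ContDiffBump (0 : EuclideanSpace ℝ (Fin n)) := ⟨r / 2, r, half_pos hr, half_lt_self hr⟩
  have hφU : tsupport φ ⊆ U := φ.tsupport_eq.trans_subset hrU
  have hΔφ : ∀ᶠ x in 𝓝 0, (Δ ⇑φ) x = 0 := by
    filter_upwards [InnerProductSpace.laplacian_congr_nhds φ.eventuallyEq_one] with x hx
    exact hx.trans (congrFun InnerProductSpace.laplacian_const x)
  obtain ⟨M, hM⟩ := exists_bound_integral_mul_laplacian_mul_punctureCutoff hw_loc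
    (by simpa only [finrank_euclideanSpace_fin] using hgrowth) φ.contDiff φ.hasCompactSupport
    hφU hΔφ
  obtain ⟨ε, -, hε_pos, hε_lim⟩ := exists_seq_strictAnti_tendsto (0 : ℝ)
  have hsub (k : ℕ) : (ball 0 (ε k))ᶜ ∩ closedBall 0 (r / 2) ⊆ U \ {0} := fun x hx =>
    ⟨hrU (closedBall_subset_closedBall (half_le_self hr.le) hx.2),
      fun h => hx.1 (Set.mem_singleton_iff.1 h ▸ mem_ball_self (hε_pos k))⟩
  refine ⟨closedBall 0 (r / 2), closedBall_mem_nhds _ (half_pos hr),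
    (aecover_compl_ball hε_lim).restrict.integrable_of_integral_norm_bounded M (fun k => ?_) ?_⟩
  · rw [IntegrableOn, Measure.restrict_restrict measurableSet_ball.compl]
    exact (hW_loc.locallyIntegrableOn_mul hV hw_loc).integrableOn_compact_subset (hsub k)
      ((isCompact_closedBall _ _).inter_left isOpen_ball.isClosed_compl)
  · filter_upwards [(tendsto_nhdsWithin_iff.2 ⟨hε_lim, Eventually.of_forall hε_pos⟩).eventually hM]
      with k hk
    rw [Measure.restrict_restrict measurableSet_ball.compl]
    refine (hw.setIntegral_norm_mul_le hV hW_loc hw_loc hWw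
      (φ.contDiff.mul (contDiff_punctureCutoff (ε k))) φ.hasCompactSupport.mul_right
      ((tsupport_mul_punctureCutoff_subset (hε_pos k)).trans (Set.sdiff_subset_sdiff_left hφU))
      (fun x => mul_nonneg φ.nonneg (punctureCutoff_mem_Icc _ x).1)
      (measurableSet_ball.compl.inter measurableSet_closedBall) (hsub k) fun x hx => ?_).trans hk
    rw [φ.one_of_mem_closedBall hx.2, one_mul,
      punctureCutoff_eq_one (hε_pos k) (not_lt.1 (hx.1 ∘ mem_ball_zero_iff.2))]

theorem IsWeakSolution.eq_zero_of_nonneg (hn : 1 ≤ n) (hw : IsWeakSolution W w (U \ {0}))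
    (hU : IsOpen U) (hconn : IsPreconnected U) (h0 : 0 ∈ U)
    (hW_loc : MemLinftyLoc W (U \ {0})) (hW_nonneg : ∀ᵐ x ∂volume.restrict U, 0 ≤ W x)
    (hW_not_L1 : ¬IntegrableAtFilter W (𝓝 0))
    (hW_inv : ∃ r : ℝ, 0 < r ∧
      ∫⁻ x in ball (0 : EuclideanSpace ℝ (Fin n)) r,
        (ENNReal.ofReal (‖x‖ ^ (n + 2) * W x))⁻¹ < ⊤)
    (hw_loc : LocallyIntegrableOn w (U \ {0}))
    (hw_growth : w =O[𝓝 0 ⊓ ae volume] fun x => ‖x‖ ^ (2 - (n : ℤ)))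
    (hw_nonneg : ∀ᵐ x ∂volume.restrict U, 0 ≤ w x) : ∀ᵐ x ∂volume.restrict U, w x = 0 := by
  have : Nonempty (Fin n) := ⟨⟨0, hn⟩⟩
  have hU0 : U ∈ 𝓝 0 := hU.mem_nhds h0
  have hW_meas := hW_loc.aestronglyMeasurable (hU.sdiff isClosed_singleton)
  have hWw : ∀ᵐ x ∂volume.restrict (U \ {0}), 0 ≤ W x * w x := by
    refine ae_restrict_of_ae_restrict_of_subset Set.sdiff_subset ?_
    filter_upwards [hW_nonneg, hw_nonneg] with x hWx hwx using mul_nonneg hWx hwx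
  have hgrowth := isBigO_div_norm_sq hw_growth
  have hWw_int := hw.integrableAtFilter_mul hU h0 hW_loc hw_loc hWw hgrowth
  obtain ⟨hW_pos, hinv⟩ := eventually_pos_and_integrableAtFilter_inv hU0 hW_meas hW_inv
  have hdiv := integrableAtFilter_div_norm_sq hU0 hw_loc.aestronglyMeasurable hWw_int hinv hW_pos
    (eventually_nhds_inf_ae_of_ae_restrict hU0 hw_nonneg) hgrowth
  have hw_locU := locallyIntegrableOn_of_sdiff_singleton hw_loc
    (integrableAtFilter_of_div_norm_sq hdiv)
  have hsuper := (hw.weaklySuperharmonicOn hWw).of_sdiff_singleton hw_locU hdiv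
  refine (hsuper.strong_minimum_principle hU hconn hw_locU hw_nonneg).resolve_right fun hpos => ?_
  obtain ⟨c, hc, hcw⟩ := hpos 0 h0
  exact hW_not_L1 (integrableAtFilter_of_mul_of_pos_le
    ⟨_, sdiff_singleton_mem_nhds_inf_ae hU0, hW_meas⟩ hWw_int hc hcw)

end Schrodinger

theorem theorem4p1_general (n : ℕ) (hn : 1 ≤ n) (W w : EuclideanSpace ℝ (Fin n) → ℝ)
    {U : Set (EuclideanSpace ℝ (Fin n))} (hU : IsOpen U) (hconn : IsPreconnected U) (h0 : 0 ∈ U)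
    (hW_loc : MemLinftyLoc W (U \ {0})) (hW_nonneg : ∀ᵐ x ∂volume.restrict U, 0 ≤ W x)
    (hW_not_L1 : ¬IntegrableAtFilter W (𝓝 0))
    (hW_inv : ∃ r : ℝ, 0 < r ∧
      ∫⁻ x in ball (0 : EuclideanSpace ℝ (Fin n)) r,
        (ENNReal.ofReal (‖x‖ ^ (n + 2) * W x))⁻¹ < ⊤)
    (hw_loc : LocallyIntegrableOn w (U \ {0})) (hw_sol : IsWeakSolution W w (U \ {0}))
    (hw_growth : w =O[𝓝 0 ⊓ ae volume] fun x => ‖x‖ ^ (2 - (n : ℤ)))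
    (hw_sign : (∀ᵐ x ∂volume.restrict U, 0 ≤ w x) ∨ ∀ᵐ x ∂volume.restrict U, w x ≤ 0) :
    ∀ᵐ x ∂volume.restrict U, w x = 0 := by
  rcases hw_sign with hw_nonneg | hw_nonpos
  · exact hw_sol.eq_zero_of_nonneg hn hU hconn h0 hW_loc hW_nonneg hW_not_L1 hW_inv hw_loc
      hw_growth hw_nonneg
  · have hneg := hw_sol.neg.eq_zero_of_nonneg hn hU hconn h0 hW_loc hW_nonneg hW_not_L1 hW_inv
      hw_loc.neg hw_growth.neg_left (hw_nonpos.mono fun x hx => neg_nonneg.2 hx)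
    exact hneg.mono fun x hx => neg_eq_zero.1 hx

theorem theorem4p1 (n : ℕ) (hn : 1 ≤ n) (W w : EuclideanSpace ℝ (Fin n) → ℝ)
    -- the potential
    (hW_loc : MemLinftyLoc W (Metric.ball 0 1 \ {0}))
    (hW_nonneg : ∀ᵐ x ∂(volume.restrict (Metric.ball (0 : EuclideanSpace ℝ (Fin n)) 1)), 0 ≤ W x)
    (hW_not_L1 : ¬ IntegrableAtFilter W (𝓝 0) volume)
    -- `1 / (|x|^(n+2) W)` is integrable near `0`, its value being `∞` where `W` vanishes
    (hW_inv : ∃ r : ℝ, 0 < r ∧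
      ∫⁻ x in Metric.ball (0 : EuclideanSpace ℝ (Fin n)) r,
        (ENNReal.ofReal (‖x‖ ^ (n + 2) * W x))⁻¹ < ⊤)
    -- the solution
    (hw_loc : LocallyIntegrableOn w (Metric.ball 0 1 \ {0}) volume)
    (hw_sol : IsWeakSolution W w (Metric.ball 0 1 \ {0}))
    -- `w = O(|x|^(2-n))` near `0`, up to null sets
    (hw_growth : w =O[𝓝 0 ⊓ ae volume] fun x => ‖x‖ ^ (2 - (n : ℤ)))
    (hw_sign :
      (∀ᵐ x ∂(volume.restrict (Metric.ball (0 : EuclideanSpace ℝ (Fin n)) 1)), 0 ≤ w x) ∨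
      (∀ᵐ x ∂(volume.restrict (Metric.ball (0 : EuclideanSpace ℝ (Fin n)) 1)), w x ≤ 0)) :
    ∀ᵐ x ∂(volume.restrict (Metric.ball (0 : EuclideanSpace ℝ (Fin n)) 1)), w x = 0 := by
  exact theorem4p1_general n hn W w Metric.isOpen_ball (convex_ball 0 1).isPreconnected
    (mem_ball_self one_pos) hW_loc hW_nonneg hW_not_L1 hW_inv hw_loc hw_sol hw_growth hw_sign
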